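/- Let $p$ be a prime of the form $p = 2^a(2b+1)-1$ with integers $a\ge 2$, $b\ge 0$ (in particular, $p$ may be any Mersenne prime $p=2^q-1$ with $q$ prime, with $a=q$, $b=0$). For positive integers $i,j,m,n$ and a commutative ring $A$ let $$R(A;i,j,m,n)=A\langle x,y : x^iy^m+y^nx^j=1,\ y^{m+n}=0\rangle$$ be the quotient of the free $A$-algebra on $x,y$ by the two-sided ideal generated by the two relations, and let $\mathcal{A}_A$ be the set of all quadruples $(i,j,m,n)$ of positive integers for which there is a non-trivial unital $A$-algebra homomorphism $R(A;i,j,m,n)\to M_{m+n}(A)$. Let $\mathbb{Z}_p$ be the field with $p$ elements and let $\nu_2$ be the $2$-adic valuation on $\mathbb{Z}$, with $\nu_2(0)=\infty$. An odd multiple of an integer $g$ is an integer $kg$ with $k\in\mathbb{Z}$ odd. Then, for all positive integers $i,j$, we have $(i,j,1,1)\in\mathcal{A}_{\mathbb{Z}_p}$ if and only if at least one of the following holds: (I) $i$ and $j$ are both odd; (II) $i$ and $j$ have distinct parity and $\gcd(j-i,p-1)$ is not an odd multiple of $\gcd(j+i,p-1)$; (III) for some $\ell\in\{1,\dots,p-1\}$,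 either $(i,j)\equiv(\ell(p+1),\,(p+1)(p-\ell)+p)\pmod{2p}$ or $(i,j)\equiv((p+1)(p-\ell)+p,\,\ell(p+1))\pmod{2p}$, where the congruences are componentwise; (IV) $\nu_2(j-ip)\le a$ and $j-i$ is not an odd multiple of $\gcd(j-ip,\,(p+1)(j-i),\,p^2-1)$. -/

import Mathlib

/-- The defining relations `x ^ i * y ^ m + y ^ n * x ^ j = 1` and `y ^ (m + n) = 0` on the
free `A`-algebra on two indeterminates; the generator `0` is `x` and the generator `1` is `y`. -/
inductive TwoElementRel (A : Type*) [CommRing A] (i j m n : ℕ) :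
    FreeAlgebra A (Fin 2) → FreeAlgebra A (Fin 2) → Prop
  | unit : TwoElementRel A i j m n
      (FreeAlgebra.ι A 0 ^ i * FreeAlgebra.ι A 1 ^ m +
        FreeAlgebra.ι A 1 ^ n * FreeAlgebra.ι A 0 ^ j) 1
  | nilp : TwoElementRel A i j m n (FreeAlgebra.ι A 1 ^ (m + n)) 0

/-- The `A`-algebra `R(A; i, j, m, n) = A⟨x, y : x ^ i y ^ m + y ^ n x ^ j = 1, y ^ (m + n) = 0⟩`:
the quotient of the free algebra by the two-sided ideal generated by the relations. -/
abbrev TwoElementAlgebra (A : Type*) [CommRing A] (i j m n : ℕ) :=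
  RingQuot (TwoElementRel A i j m n)

/-- The set `𝒜_A` of the quadruples `(i, j, m, n)` of positive integers for which there is a
non-trivial (unital) homomorphism of `A`-algebras `R(A; i, j, m, n) → M_{m+n}(A)`. -/
def matrixHomSet (A : Type*) [CommRing A] : Set (ℕ × ℕ × ℕ × ℕ) :=
  {t | ∃ i j m n : ℕ, t = (i, j, m, n) ∧ 0 < i ∧ 0 < j ∧ 0 < m ∧ 0 < n ∧
    ∃ f : TwoElementAlgebra A i j m n →ₐ[A] Matrix (Fin (m + n)) (Fin (m + n)) A, ∃ r, f r ≠ 0}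

/-- `u` is an odd multiple of `g`. -/
def IsOddMultiple (u g : ℤ) : Prop := ∃ k : ℤ, Odd k ∧ u = k * g

/-! A homomorphism amounts to 2×2 matrices `X`, `Y` satisfying the relations. By Cayley–Hamilton the
powers of `X` are combinations of `X` and `1` with Lucas-sequence coefficients, so `Y` can be
eliminated and only a condition on the trace and determinant of `X` remains
(`exists_matrix_iff_exists_lucasU`). For the eigenvalues `α`, `β` in an algebraic closure it reads
`α^i = -β^j`, `α^j = -β^i`, with `α^i ≠ β^i` if `α ≠ β` and a derivative condition if `α = β`
(`lucasU_condition_iff`).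

Since the characteristic polynomial is defined over the prime field, Frobenius fixes or swaps `α`
and `β`. Distinct fixed eigenvalues lead to (I) or (II), a double eigenvalue to (I) or (III),
swapped ones to (IV). The shape of `p` enters through two facts: `(p - 1) / 2` is odd, which
excludes `i`, `j` both even in the fixed cases, and `2^(a+1)` is the exact power of 2 in `p^2 - 1`,
which gives the bound in (IV). -/

/-! ### Homomorphisms as pairs of matrices. -/

theorem mem_matrixHomSet_iff_exists_matrix {F : Type*} [Field F] {i j : ℕ} (hi : 0 < i)
    (hj : 0 < j) :
    (i, j, 1, 1) ∈ matrixHomSet F ↔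
      ∃ X Y : Matrix (Fin 2) (Fin 2) F, X ^ i * Y + Y * X ^ j = 1 ∧ Y ^ 2 = 0 := by
  constructor
  · rintro ⟨i', j', m, n, h, -, -, -, -, f, -⟩
    obtain ⟨rfl, rfl, rfl, rfl⟩ : i = i' ∧ j = j' ∧ 1 = m ∧ 1 = n := by simpa using h
    let q := RingQuot.mkAlgHom F (TwoElementRel F i j 1 1)
    refine ⟨f (q (FreeAlgebra.ι F 0)), f (q (FreeAlgebra.ι F 1)), ?_, ?_⟩
    · have h1 := congrArg f
        (RingQuot.mkAlgHom_rel F (TwoElementRel.unit (A := F) (i := i) (j := j) (m := 1) (n := 1)))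
      simpa using h1
    · have h1 := congrArg f
        (RingQuot.mkAlgHom_rel F (TwoElementRel.nilp (A := F) (i := i) (j := j) (m := 1) (n := 1)))
      simpa using h1
  · rintro ⟨X, Y, h1, h2⟩
    refine ⟨i, j, 1, 1, rfl, hi, hj, one_pos, one_pos,
      RingQuot.liftAlgHom F ⟨FreeAlgebra.lift F ![X, Y], ?_⟩, 1, ?_⟩
    · rintro _ _ (_ | _)
      · simpa using h1
      · simpa using h2
    · rw [map_one]
      exact one_ne_zero

/-! ### Lucas sequences and the condition on trace and determinant. -/

/-- The Lucas sequence `u` of the polynomial `x ^ 2 - t x + q`. -/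
def lucasU {R : Type*} [CommRing R] (t q : R) : ℕ → R
  | 0 => 0
  | 1 => 1
  | n + 2 => t * lucasU t q (n + 1) - q * lucasU t q n

theorem pow_succ_eq_lucasU {R : Type*} [CommRing R] (X : Matrix (Fin 2) (Fin 2) R) (n : ℕ) :
    X ^ (n + 1) = lucasU X.trace X.det (n + 1) • X - (X.det * lucasU X.trace X.det n) • 1 := by
  have hX : X * X = X.trace • X - X.det • 1 := by
    ext r c
    fin_cases r <;> fin_cases c <;>
      simp [Matrix.mul_apply, Fin.sum_univ_two, Matrix.trace_fin_two, Matrix.det_fin_two] <;> ring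
  induction n with
  | zero => simp [lucasU]
  | succ n ih =>
    rw [pow_succ, ih, sub_mul, smul_mul_assoc, hX, smul_mul_assoc, one_mul, lucasU]
    module

theorem exists_matrix_iff_exists_lucasU {F : Type*} [Field F] (m n : ℕ) :
    (∃ X Y : Matrix (Fin 2) (Fin 2) F, X ^ (m + 1) * Y + Y * X ^ (n + 1) = 1 ∧ Y ^ 2 = 0) ↔
      ∃ t q : F, lucasU t q (m + 1) = lucasU t q (n + 1) ∧ lucasU t q (m + 1) ≠ 0 ∧
        t * lucasU t q (m + 1) = q * (lucasU t q m + lucasU t q n) := by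
  constructor
  · rintro ⟨X, Y, h, hY⟩
    have hY0 : Y ≠ 0 := by rintro rfl; simp at h
    have htr : Y.trace = 0 :=
      (Matrix.isNilpotent_trace_of_isNilpotent ⟨2, hY⟩).eq_zero
    -- Polarized Cayley–Hamilton, simplified by `Y.trace = 0`.
    have hpol : X * Y + Y * X = X.trace • Y + (X * Y).trace • 1 := by
      have : Y 1 1 = - Y 0 0 := by
        rw [Matrix.trace_fin_two] at htr
        linear_combination htr
      ext r c
      fin_cases r <;> fin_cases c <;>
        simp [Matrix.mul_apply, Fin.sum_univ_two, Matrix.trace_fin_two, this] <;> ring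
    rw [pow_succ_eq_lucasU X m, pow_succ_eq_lucasU X n] at h
    generalize X.det = q at *
    generalize X.trace = t at *
    generalize (X * Y).trace = s at *
    rw [pow_two] at hY
    have hYXY : Y * X * Y = s • Y := by
      have := congrArg (Y * ·) hpol
      simpa [mul_add, ← mul_assoc, hY] using this
    have key : ∀ c : F, c • Y = Y → c = 1 := fun c hc => by
      have : (c - 1) • Y = 0 := by rw [sub_smul, hc, one_smul, sub_self]
      exact sub_eq_zero.1 ((smul_eq_zero.1 this).resolve_right hY0)
    have h1 : lucasU t q (m + 1) * s = 1 := key _ (by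
      have := congrArg (Y * ·) h
      simpa [mul_add, mul_sub, sub_mul, ← mul_assoc, hY, hYXY, smul_smul] using this)
    have h2 : lucasU t q (n + 1) * s = 1 := key _ (by
      have := congrArg (· * Y) h
      simpa [add_mul, mul_sub, sub_mul, mul_assoc, hY, smul_smul] using
        (by simpa [add_mul, mul_sub, sub_mul, mul_assoc, hY, (mul_assoc Y X Y).symm.trans hYXY,
          smul_smul] using this))
    have hs : s ≠ 0 := right_ne_zero_of_mul_eq_one h1
    have hu : lucasU t q (m + 1) = lucasU t q (n + 1) := mul_right_cancel₀ hs (h1.trans h2.symm)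
    refine ⟨t, q, hu, left_ne_zero_of_mul_eq_one h1, ?_⟩
    have h3 : lucasU t q (m + 1) • (X * Y + Y * X) -
        (q * (lucasU t q m + lucasU t q n)) • Y = 1 := by
      rw [← h, ← hu]
      simp only [sub_mul, mul_sub, smul_mul_assoc, mul_smul_comm, one_mul, mul_one]
      module
    rw [hpol] at h3
    have h4 : (t * lucasU t q (m + 1) - q * (lucasU t q m + lucasU t q n)) • Y = 0 := by
      calc _ = lucasU t q (m + 1) • (t • Y + s • 1) - (q * (lucasU t q m + lucasU t q n)) • Y -
            (lucasU t q (m + 1) * s) • 1 := by module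
        _ = 0 := by rw [h3, h1, one_smul, sub_self]
    exact sub_eq_zero.1 ((smul_eq_zero.1 h4).resolve_right hY0)
  · rintro ⟨t, q, hu, hu0, h⟩
    set u := lucasU t q (m + 1) with hudef
    have hXt : (!![0, -q * u; u⁻¹, t] : Matrix (Fin 2) (Fin 2) F).trace = t := by
      simp [Matrix.trace_fin_two]
    have hXd : (!![0, -q * u; u⁻¹, t] : Matrix (Fin 2) (Fin 2) F).det = q := by
      simp [Matrix.det_fin_two, hu0]
    -- With `Y` the nilpotent unit matrix, the trace of `X * Y` is the lower left entry of `X`; the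
    -- forward direction shows it must be `u⁻¹`.
    refine ⟨!![0, -q * u; u⁻¹, t], !![0, 1; 0, 0], ?_, ?_⟩
    · rw [pow_succ_eq_lucasU, pow_succ_eq_lucasU, hXt, hXd, ← hu, ← hudef,
        Matrix.one_fin_two]
      ext r c
      fin_cases r <;> fin_cases c <;>
        simp [hu0]
      linear_combination h
    · ext r c
      fin_cases r <;> fin_cases c <;> simp [pow_two]

/-! ### From trace and determinant to eigenvalues. -/

theorem mem_range_algebraMap_of_pow_eq_self {p : ℕ} [Fact p.Prime] {K : Type*} [Field K]
    [Algebra (ZMod p) K] {x : K} (h : x ^ p = x) : ∃ c : ZMod p, algebraMap (ZMod p) K c = x := by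
  have : CharP K p := charP_of_injective_algebraMap (algebraMap (ZMod p) K).injective p
  have hx := (Subfield.mem_bot_iff_pow_eq_self K p).2 h
  rw [← ZMod.fieldRange_castHom_eq_bot p] at hx
  obtain ⟨c, hc⟩ := hx
  exact ⟨c, by rw [← hc]; exact RingHom.congr_fun (Subsingleton.elim _ _) c⟩

theorem map_lucasU {R S : Type*} [CommRing R] [CommRing S] (f : R →+* S) (t q : R) :
    ∀ n, f (lucasU t q n) = lucasU (f t) (f q) n
  | 0 => by simp [lucasU]
  | 1 => by simp [lucasU]
  | n + 2 => by simp [lucasU, map_lucasU f t q n, map_lucasU f t q (n + 1)]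

theorem sub_mul_lucasU {R : Type*} [CommRing R] (α β : R) :
    ∀ n, (α - β) * lucasU (α + β) (α * β) n = α ^ n - β ^ n
  | 0 => by simp [lucasU]
  | 1 => by simp [lucasU]
  | n + 2 => by
    rw [lucasU]
    linear_combination (α + β) * sub_mul_lucasU α β (n + 1) - α * β * sub_mul_lucasU α β n

/-- The left side is the companion Lucas sequence, shifted by one; it turns the third matrix
condition into a statement about power sums. -/
theorem lucasU_companion {R : Type*} [CommRing R] (α β : R) :
    ∀ n, (α + β) * lucasU (α + β) (α * β) (n + 1) - 2 * (α * β) * lucasU (α + β) (α * β) n =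
      α ^ (n + 1) + β ^ (n + 1)
  | 0 => by simp [lucasU]
  | 1 => by simp [lucasU]; ring
  | n + 2 => by
    have h1 := lucasU_companion α β (n + 1)
    have h0 := lucasU_companion α β n
    rw [lucasU] at h1
    rw [lucasU, lucasU]
    linear_combination (α + β) * h1 - α * β * h0

theorem lucasU_double {R : Type*} [CommRing R] (α : R) :
    ∀ n, lucasU (α + α) (α * α) (n + 1) = (n + 1) * α ^ n
  | 0 => by simp [lucasU]
  | 1 => by simp [lucasU]; ring
  | n + 2 => by
    rw [lucasU, lucasU_double α (n + 1), lucasU_double α n]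
    push_cast
    ring

/-- Given equal Lucas terms, twice the third equation says that the power sums of exponents `m + 1`
and `n + 1` add to zero. For `α ≠ β`, equal Lucas terms mean equal differences of powers; sum and
difference then separate into the two equations on the right. For `α = β` the Lucas term is the
derivative `(m + 1) * α ^ m`. -/
theorem lucasU_condition_iff {K : Type*} [Field K] (h2 : (2 : K) ≠ 0) (α β : K) (m n : ℕ) :
    (lucasU (α + β) (α * β) (m + 1) = lucasU (α + β) (α * β) (n + 1) ∧
      lucasU (α + β) (α * β) (m + 1) ≠ 0 ∧
      (α + β) * lucasU (α + β) (α * β) (m + 1) =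
        α * β * (lucasU (α + β) (α * β) m + lucasU (α + β) (α * β) n)) ↔
    α ^ (m + 1) = -β ^ (n + 1) ∧ α ^ (n + 1) = -β ^ (m + 1) ∧
      ((α ≠ β ∧ α ^ (m + 1) ≠ β ^ (m + 1)) ∨
       (α = β ∧ ((m + 1 : ℕ) : K) * α ^ m = ((n + 1 : ℕ) : K) * α ^ n ∧
          ((m + 1 : ℕ) : K) * α ^ m ≠ 0)) := by
  have hm := lucasU_companion α β m
  have hn := lucasU_companion α β n
  have em := sub_mul_lucasU α β (m + 1)
  have en := sub_mul_lucasU α β (n + 1)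
  by_cases hαβ : α = β
  · subst hαβ
    have dm := lucasU_double α m
    have dn := lucasU_double α n
    simp only [ne_eq, not_true_eq_false, false_and, true_and, false_or]
    push_cast
    rw [← dm, ← dn]
    constructor
    · rintro ⟨h, h0, h'⟩
      have : α ^ (m + 1) = -α ^ (n + 1) := by
        apply mul_left_cancel₀ h2
        linear_combination -hm - hn + 2 * h' - (α + α) * h
      exact ⟨this, by rw [this, neg_neg], h, h0⟩
    · rintro ⟨h1, -, h, h0⟩
      refine ⟨h, h0, mul_left_cancel₀ h2 ?_⟩
      linear_combination hm + hn + 2 * h1 + (α + α) * h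
  · have hd : α - β ≠ 0 := sub_ne_zero.2 hαβ
    simp only [hαβ, ne_eq, not_false_eq_true, true_and, false_and, or_false]
    constructor
    · rintro ⟨h, h0, h'⟩
      refine ⟨mul_left_cancel₀ h2 ?_, mul_left_cancel₀ h2 ?_, fun he => ?_⟩
      · linear_combination -hm - hn - em + en + 2 * h' + (α - β - (α + β)) * h
      · linear_combination -hm - hn + em - en + 2 * h' - (α - β + (α + β)) * h
      · rw [he, sub_self] at em
        exact (mul_ne_zero hd h0) em
    · rintro ⟨h1, h3, h4⟩
      have h : lucasU (α + β) (α * β) (m + 1) = lucasU (α + β) (α * β) (n + 1) :=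
        mul_left_cancel₀ hd (by linear_combination em - en + h1 - h3)
      refine ⟨h, fun h0 => h4 ?_, mul_left_cancel₀ h2 ?_⟩
      · rw [h0, mul_zero] at em
        exact sub_eq_zero.1 em.symm
      · linear_combination hm + hn + h1 + h3 + (α + β) * h

theorem exists_lucasU_iff_exists_roots {p : ℕ} [Fact p.Prime] (hp2 : p ≠ 2) (K : Type*) [Field K]
    [Algebra (ZMod p) K] [IsAlgClosed K] (m n : ℕ) :
    (∃ t q : ZMod p, lucasU t q (m + 1) = lucasU t q (n + 1) ∧ lucasU t q (m + 1) ≠ 0 ∧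
        t * lucasU t q (m + 1) = q * (lucasU t q m + lucasU t q n)) ↔
    ∃ α β : K, ((α ^ p = α ∧ β ^ p = β) ∨ (α ^ p = β ∧ β ^ p = α)) ∧
      α ^ (m + 1) = -β ^ (n + 1) ∧ α ^ (n + 1) = -β ^ (m + 1) ∧
      ((α ≠ β ∧ α ^ (m + 1) ≠ β ^ (m + 1)) ∨
       (α = β ∧ ((m + 1 : ℕ) : K) * α ^ m = ((n + 1 : ℕ) : K) * α ^ n ∧
          ((m + 1 : ℕ) : K) * α ^ m ≠ 0)) := by
  have hp : p.Prime := Fact.out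
  have : CharP K p := charP_of_injective_algebraMap (algebraMap (ZMod p) K).injective p
  have h2 : (2 : K) ≠ 0 := by
    intro h
    have : ((2 : ℕ) : K) = 0 := by exact_mod_cast h
    rw [CharP.cast_eq_zero_iff K p] at this
    exact hp2 ((Nat.prime_dvd_prime_iff_eq hp Nat.prime_two).1 this)
  have hinj : Function.Injective (algebraMap (ZMod p) K) := (algebraMap (ZMod p) K).injective
  have transfer : ∀ t q : ZMod p, (lucasU t q (m + 1) = lucasU t q (n + 1) ∧
      lucasU t q (m + 1) ≠ 0 ∧ t * lucasU t q (m + 1) = q * (lucasU t q m + lucasU t q n)) ↔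
      (lucasU (algebraMap _ K t) (algebraMap _ K q) (m + 1) =
        lucasU (algebraMap _ K t) (algebraMap _ K q) (n + 1) ∧
      lucasU (algebraMap _ K t) (algebraMap _ K q) (m + 1) ≠ 0 ∧
      algebraMap _ K t * lucasU (algebraMap _ K t) (algebraMap _ K q) (m + 1) =
        algebraMap _ K q * (lucasU (algebraMap _ K t) (algebraMap _ K q) m +
          lucasU (algebraMap _ K t) (algebraMap _ K q) n)) := by
    intro t q
    simp only [← map_lucasU, ← map_add, ← map_mul, hinj.eq_iff, ne_eq, map_eq_zero]
  constructor
  · rintro ⟨t, q, h⟩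
    rw [transfer] at h
    have ht : algebraMap (ZMod p) K t ^ p = algebraMap _ K t := by rw [← map_pow, ZMod.pow_card]
    have hq : algebraMap (ZMod p) K q ^ p = algebraMap _ K q := by rw [← map_pow, ZMod.pow_card]
    obtain ⟨α, hα⟩ := IsAlgClosed.exists_eval₂_eq_zero (algebraMap (ZMod p) K)
      (Polynomial.X ^ 2 - Polynomial.C t * Polynomial.X + Polynomial.C q) (by
        rw [show (Polynomial.X ^ 2 - Polynomial.C t * Polynomial.X + Polynomial.C q :
          Polynomial (ZMod p)).degree = 2 by compute_degree!]
        norm_num)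
    simp only [Polynomial.eval₂_add, Polynomial.eval₂_sub, Polynomial.eval₂_pow,
      Polynomial.eval₂_X, Polynomial.eval₂_mul, Polynomial.eval₂_C] at hα
    generalize algebraMap (ZMod p) K t = t' at *
    generalize algebraMap (ZMod p) K q = q' at *
    obtain ⟨β, rfl⟩ : ∃ β, t' = α + β := ⟨t' - α, by ring⟩
    obtain rfl : q' = α * β := by linear_combination hα
    refine ⟨α, β, ?_, (lucasU_condition_iff h2 α β m n).1 h⟩
    rw [add_pow_char] at ht
    rw [mul_pow] at hq
    -- Frobenius fixes the coefficients, so `α ^ p` is again a root.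
    have hroot : (α ^ p - α) * (α ^ p - β) = 0 := by
      linear_combination α ^ p * ht - hq
    rcases mul_eq_zero.1 hroot with h0 | h0
    · exact .inl ⟨sub_eq_zero.1 h0, by linear_combination ht - h0⟩
    · exact .inr ⟨sub_eq_zero.1 h0, by linear_combination ht - h0⟩
  · rintro ⟨α, β, hαβ, h⟩
    have ht : (α + β) ^ p = α + β := by
      rw [add_pow_char]
      rcases hαβ with ⟨h1, h2⟩ | ⟨h1, h2⟩ <;> rw [h1, h2]
      exact add_comm _ _
    have hq : (α * β) ^ p = α * β := by
      rw [mul_pow]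
      rcases hαβ with ⟨h1, h2⟩ | ⟨h1, h2⟩ <;> rw [h1, h2]
      exact mul_comm _ _
    obtain ⟨t, ht⟩ := mem_range_algebraMap_of_pow_eq_self ht
    obtain ⟨q, hq⟩ := mem_range_algebraMap_of_pow_eq_self hq
    refine ⟨t, q, (transfer t q).2 ?_⟩
    rw [ht, hq]
    exact (lucasU_condition_iff h2 α β m n).2 h

/-! ### Distinct eigenvalues in the prime field. -/

/-- Raising to the odd power `h` would turn the equality into `1 = -1`. -/
theorem pow_ne_neg_pow_of_even {K : Type*} [Field K] (h2 : (2 : K) ≠ 0) {h : ℕ} (hh : Odd h)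
    {α β : K} (hα : α ^ (2 * h) = 1) (hβ : β ^ (2 * h) = 1) {i j : ℕ} (hi : Even i) (hj : Even j) :
    α ^ i ≠ -β ^ j := by
  obtain ⟨k, rfl⟩ := even_iff_two_dvd.1 hi
  obtain ⟨l, rfl⟩ := even_iff_two_dvd.1 hj
  intro he
  have he' := congrArg (· ^ h) he
  simp only [hh.neg_pow] at he'
  rw [← pow_mul, ← pow_mul, show 2 * k * h = 2 * h * k by ring, show 2 * l * h = 2 * h * l by ring,
    pow_mul α (2 * h),
    pow_mul β (2 * h), hα, hβ, one_pow, one_pow] at he'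
  exact h2 (by linear_combination he')

theorem dvd_left_of_dvd_add_of_dvd_sub {d i j : ℕ} (hodd : Odd (i + j)) (h1 : d ∣ i + j)
    (h2 : (d : ℤ) ∣ (j : ℤ) - i) : d ∣ i := by
  have hd : Nat.Coprime d 2 := (hodd.of_dvd_nat h1).coprime_two_right
  have h1' : (d : ℤ) ∣ (i : ℤ) + j := by exact_mod_cast h1
  have : (d : ℤ) ∣ ((i * 2 : ℕ) : ℤ) := by
    have := dvd_sub h1' h2
    rwa [show (i : ℤ) + j - (j - i) = ((i * 2 : ℕ) : ℤ) by push_cast; ring] at this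
  exact hd.dvd_of_dvd_mul_right (Int.natCast_dvd_natCast.1 this)

/-- The order of `α / β` divides `i + j` and `p - 1`. If the gcds were multiples of each other as in
(II), it would divide `j - i`, hence `i` because `i + j` is odd, contradicting `α ^ i ≠ β ^ i`. -/
theorem parity_condition_of_split {p h : ℕ} (hph : p = 2 * h + 1) (hh : Odd h) {K : Type*} [Field K]
    (h2 : (2 : K) ≠ 0) {α β : K} (hα0 : α ≠ 0) (hβ0 : β ≠ 0) (hα : α ^ p = α) (hβ : β ^ p = β)
    {i j : ℕ} (h1 : α ^ i = -β ^ j) (h3 : α ^ j = -β ^ i) (h4 : α ^ i ≠ β ^ i) :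
    (Odd i ∧ Odd j) ∨ (¬ (Even i ↔ Even j) ∧
        ¬ IsOddMultiple (gcd ((j : ℤ) - i) ((p : ℤ) - 1)) (gcd ((j : ℤ) + i) ((p : ℤ) - 1))) := by
  subst hph
  have hα' : α ^ (2 * h) = 1 := mul_right_cancel₀ hα0 (by rw [← pow_succ, hα, one_mul])
  have hβ' : β ^ (2 * h) = 1 := mul_right_cancel₀ hβ0 (by rw [← pow_succ, hβ, one_mul])
  have hee := fun hi hj => pow_ne_neg_pow_of_even h2 hh hα' hβ' (i := i) (j := j) hi hj h1
  by_cases hpar : Even i ↔ Even j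
  · left
    by_cases hi : Even i
    · exact (hee hi (hpar.1 hi)).elim
    · exact ⟨Nat.not_even_iff_odd.1 hi, Nat.not_even_iff_odd.1 (fun hj => hi (hpar.2 hj))⟩
  · refine .inr ⟨hpar, ?_⟩
    rintro ⟨k, -, hk⟩
    have hodd : Odd (i + j) := by
      rw [← Nat.not_even_iff_odd, Nat.even_add]; exact hpar
    have hd1 : orderOf (α / β) ∣ i + j := by
      apply orderOf_dvd_of_pow_eq_one
      rw [div_pow, div_eq_one_iff_eq (pow_ne_zero _ hβ0), pow_add, pow_add, h3, h1]
      rw [← h1]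
      linear_combination (-β ^ i) * h1
    have hd2 : orderOf (α / β) ∣ 2 * h := by
      apply orderOf_dvd_of_pow_eq_one
      rw [div_pow, hα', hβ', div_one]
    have hd3 : ((orderOf (α / β) : ℕ) : ℤ) ∣ (j : ℤ) - i := by
      refine dvd_trans ?_ (gcd_dvd_left ((j : ℤ) - i) (((2 * h + 1 : ℕ) : ℤ) - 1))
      rw [hk]
      refine Dvd.dvd.mul_left (dvd_gcd ?_ ?_) _
      · rw [add_comm]; exact_mod_cast hd1
      · push_cast; rw [add_sub_cancel_right]; exact_mod_cast hd2
    have := orderOf_dvd_iff_pow_eq_one.1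
      (dvd_left_of_dvd_add_of_dvd_sub hodd hd1 hd3)
    rw [div_pow, div_eq_one_iff_eq (pow_ne_zero _ hβ0)] at this
    exact h4 this

theorem exists_split_of_not_isOddMultiple {p : ℕ} (hp2 : Odd p) {K : Type*} [Field K]
    (hζ : ∀ d : ℕ, d ∣ p - 1 → ∃ ζ : K, IsPrimitiveRoot ζ d) {i j : ℕ}
    (hpar : ¬ (Even i ↔ Even j))
    (hodd : ¬ IsOddMultiple (gcd ((j : ℤ) - i) ((p : ℤ) - 1)) (gcd ((j : ℤ) + i) ((p : ℤ) - 1))) :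
    ∃ α β : K, α ^ p = α ∧ β ^ p = β ∧ α ^ i = -β ^ j ∧ α ^ j = -β ^ i ∧ α ^ i ≠ β ^ i := by
  have hp : 1 ≤ p := hp2.pos
  have hij : Odd (i + j) := by
    rw [← Nat.not_even_iff_odd, Nat.even_add]; exact hpar
  obtain ⟨γ, hγ⟩ := hζ (Nat.gcd (i + j) (p - 1)) (Nat.gcd_dvd_right _ _)
  have hγ1 : γ ^ (i + j) = 1 := (hγ.pow_eq_one_iff_dvd _).2 (Nat.gcd_dvd_left _ _)
  have hγp : γ ^ (p - 1) = 1 := (hγ.pow_eq_one_iff_dvd _).2 (Nat.gcd_dvd_right _ _)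
  have hγ0 : γ ≠ 0 := by
    rintro rfl
    rw [zero_pow (by rintro h; simp [h] at hij)] at hγ1
    exact zero_ne_one hγ1
  have hγi : γ ^ (2 * i) ≠ 1 := by
    intro hone
    rw [hγ.pow_eq_one_iff_dvd] at hone
    set d := Nat.gcd (i + j) (p - 1) with hd
    have hdodd : Odd d := hij.of_dvd_nat (Nat.gcd_dvd_left _ _)
    have hdi : (d : ℤ) ∣ i := by
      exact_mod_cast (Nat.Coprime.dvd_of_dvd_mul_left hdodd.coprime_two_right hone)
    have hdij : (d : ℤ) ∣ (i : ℤ) + j := by exact_mod_cast Nat.gcd_dvd_left (i + j) (p - 1)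
    have hgd : gcd ((j : ℤ) + i) ((p : ℤ) - 1) = d := by
      rw [hd, show ((j : ℤ) + i) = ((i + j : ℕ) : ℤ) by push_cast; ring,
        show (p : ℤ) - 1 = ((p - 1 : ℕ) : ℤ) by push_cast [hp]; ring]
      exact Int.coe_gcd _ _ |>.symm
    obtain ⟨k, hk⟩ : (d : ℤ) ∣ gcd ((j : ℤ) - i) ((p : ℤ) - 1) := by
      refine dvd_gcd ?_ (hgd ▸ gcd_dvd_right _ _)
      have := dvd_sub hdij (hdi.mul_left 2)
      convert this using 1
      ring
    refine hodd ⟨k, ?_, by rw [hk, hgd, mul_comm]⟩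
    have hodd' : Odd ((j : ℤ) - i) := by
      have : Odd ((i + j : ℕ) : ℤ) := by exact_mod_cast hij
      push_cast at this
      rw [show (j : ℤ) - i = i + j - 2 * i by ring]
      exact this.sub_even (even_two_mul _)
    obtain ⟨c, hc⟩ : k ∣ (j : ℤ) - i :=
      (Dvd.intro_left _ hk.symm).trans (gcd_dvd_left _ _)
    rw [hc] at hodd'
    -- The quotient `k` of the two gcds is odd because it divides the odd number `j - i`.
    exact (Int.odd_mul.1 hodd').1
  have hfix : ∀ x : K, x ^ (p - 1) = 1 → x ^ p = x := fun x hx => by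
    rw [← Nat.sub_add_cancel hp, pow_succ, hx, one_mul]
  have hfixneg : ∀ x : K, x ^ p = x → (-x) ^ p = -x := fun x hx => by
    rw [hp2.neg_pow, hx]
  -- As `γ ^ (i + j) = 1`, the powers `γ ^ i` and `γ⁻¹ ^ j` agree; since `i`, `j` have opposite
  -- parity, negating both bases supplies the missing sign.
  refine ⟨-γ, -γ⁻¹, hfixneg _ (hfix _ hγp), hfixneg _ (hfix _ (by rw [inv_pow, hγp, inv_one])), ?_⟩
  have e1 : γ ^ i = (γ⁻¹) ^ j := by
    rw [inv_pow]; exact eq_inv_of_mul_eq_one_left (by rw [← pow_add, hγ1])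
  have e2 : γ ^ j = (γ⁻¹) ^ i := by
    rw [inv_pow]; exact eq_inv_of_mul_eq_one_right (by rw [← pow_add, hγ1])
  have e3 : γ ^ i ≠ (γ⁻¹) ^ i := by
    intro h
    rw [inv_pow] at h
    apply hγi
    rw [two_mul, pow_add]
    nth_rewrite 1 [h]
    exact inv_mul_cancel₀ (pow_ne_zero _ hγ0)
  rcases Nat.even_or_odd i with hi | hi <;> rcases Nat.even_or_odd j with hj | hj
  · exact (hpar (by simp [hi, hj])).elim
  · rw [hi.neg_pow, hj.neg_pow, hi.neg_pow, hj.neg_pow]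
    exact ⟨by rw [e1, neg_neg], by rw [e2], e3⟩
  · rw [hi.neg_pow, hj.neg_pow, hi.neg_pow, hj.neg_pow]
    exact ⟨by rw [e1], by rw [e2, neg_neg], fun h => e3 (neg_injective h)⟩
  · exact (hpar (by simp [Nat.not_even_iff_odd.2 hi, Nat.not_even_iff_odd.2 hj])).elim

/-! ### A double eigenvalue, and the congruences of (III). -/

theorem double_root_forward {p h : ℕ} (hph : p = 2 * h + 1) (hh : Odd h) {K : Type*} [Field K]
    [CharP K p] (h2 : (2 : K) ≠ 0) {α : K} (hα : α ^ p = α) {m n : ℕ}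
    (h1 : α ^ (m + 1) = -α ^ (n + 1))
    (h3 : ((m + 1 : ℕ) : K) * α ^ m = ((n + 1 : ℕ) : K) * α ^ n)
    (h4 : ((m + 1 : ℕ) : K) * α ^ m ≠ 0) :
    (Odd (m + 1) ∧ Odd (n + 1)) ∨
      (¬ (Even (m + 1) ↔ Even (n + 1)) ∧ p ∣ (m + 1) + (n + 1) ∧ ¬ p ∣ m + 1) := by
  -- A zero eigenvalue survives only through `0 ^ 0 = 1`, that is, for both exponents equal to 1.
  by_cases hα0 : α = 0
  · subst hα0
    have hm : m = 0 := by
      by_contra hm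
      simp [zero_pow hm] at h4
    have hn : n = 0 := by
      by_contra hn
      rw [h3, zero_pow hn, mul_zero] at h4
      exact h4 rfl
    subst hm hn
    simp
  · have hα' : α ^ (2 * h) = 1 := mul_right_cancel₀ hα0 (by rw [← pow_succ, ← hph, hα, one_mul])
    have hee := fun hi hj => pow_ne_neg_pow_of_even h2 hh hα' hα' (i := m + 1) (j := n + 1) hi hj h1
    by_cases hpar : Even (m + 1) ↔ Even (n + 1)
    · left
      by_cases hi : Even (m + 1)
      · exact (hee hi (hpar.1 hi)).elim
      · exact ⟨Nat.not_even_iff_odd.1 hi, Nat.not_even_iff_odd.1 (fun hj => hi (hpar.2 hj))⟩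
    · refine .inr ⟨hpar, ?_, fun hd => ?_⟩
      · rw [← CharP.cast_eq_zero_iff K p]
        refine (mul_eq_zero.1 (?_ : _ * α ^ (n + 1) = 0)).resolve_right (pow_ne_zero _ hα0)
        rw [Nat.cast_add]
        linear_combination ((m + 1 : ℕ) : K) * h1 - α * h3
      · rw [← CharP.cast_eq_zero_iff K p] at hd
        rw [hd, zero_mul] at h4
        exact h4 rfl

theorem double_root_backward {p : ℕ} {K : Type*} [Field K] [CharP K p] {m n : ℕ}
    (hpar : ¬ (Even (m + 1) ↔ Even (n + 1))) (h1 : p ∣ (m + 1) + (n + 1)) (h2 : ¬ p ∣ m + 1) :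
    (-1 : K) ^ (m + 1) = -(-1) ^ (n + 1) ∧
      ((m + 1 : ℕ) : K) * (-1) ^ m = ((n + 1 : ℕ) : K) * (-1) ^ n ∧
      ((m + 1 : ℕ) : K) * (-1) ^ m ≠ 0 := by
  rw [← CharP.cast_eq_zero_iff K p] at h1 h2
  rw [Nat.cast_add] at h1
  have key : (-1 : K) ^ (m + 1) = -(-1) ^ (n + 1) := by
    rcases Nat.even_or_odd (m + 1) with hi | hi <;> rcases Nat.even_or_odd (n + 1) with hj | hj
    · exact (hpar (by simp [hi, hj])).elim
    · rw [hi.neg_pow, hj.neg_pow]; simp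
    · rw [hi.neg_pow, hj.neg_pow]; simp
    · exact (hpar (by simp only [Nat.not_even_iff_odd.2 hi, Nat.not_even_iff_odd.2 hj])).elim
  refine ⟨key, ?_, mul_ne_zero h2 (pow_ne_zero _ (neg_ne_zero.2 one_ne_zero))⟩
  rw [pow_succ, pow_succ] at key
  linear_combination -((m + 1 : ℕ) : K) * key - (-1) ^ n * h1

theorem modEq_two_mul_iff {p : ℕ} (hp : Odd p) {x y : ℕ} :
    x ≡ y [MOD 2 * p] ↔ (Even x ↔ Even y) ∧ x ≡ y [MOD p] := by
  rw [← Nat.modEq_and_modEq_iff_modEq_mul hp.coprime_two_left]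
  refine and_congr_left fun _ => ?_
  rw [Nat.even_iff, Nat.even_iff, Nat.ModEq]
  omega

/-- Since `p + 1` is even and congruent to 1 modulo `p`, the listed residues encode by the Chinese
remainder theorem a parity together with the residues `l` and `-l` modulo `p`. -/
theorem exists_modEq_iff_of_even {p : ℕ} (hp : Odd p) (i j : ℕ) :
    (∃ l : ℕ, l ∈ Finset.Icc 1 (p - 1) ∧
      i ≡ l * (p + 1) [MOD 2 * p] ∧ j ≡ (p + 1) * (p - l) + p [MOD 2 * p]) ↔
    Even i ∧ Odd j ∧ p ∣ i + j ∧ ¬ p ∣ i := by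
  have he : ∀ l, Even (l * (p + 1)) := fun l => (hp.add_one).mul_left l
  have ho : ∀ l, ¬ Even ((p + 1) * (p - l) + p) := fun l =>
    Nat.not_even_iff_odd.2 (((hp.add_one).mul_right _).add_odd hp)
  have hmod : ∀ l, l * (p + 1) ≡ l [MOD p] := fun l => by
    simp [Nat.ModEq, mul_add]
  have hmod' : ∀ l, (p + 1) * (p - l) + p ≡ p - l [MOD p] := fun l => by
    simp [Nat.ModEq, add_mul]
  simp only [modEq_two_mul_iff hp, he, ho, iff_true, iff_false, Nat.not_even_iff_odd]
  constructor
  · rintro ⟨l, hl, ⟨hi, hi'⟩, hj, hj'⟩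
    rw [Finset.mem_Icc] at hl
    have hi' := hi'.trans (hmod l)
    have hj' := hj'.trans (hmod' l)
    refine ⟨hi, hj, ?_, fun hd => ?_⟩
    · have := hi'.add hj'
      rw [show l + (p - l) = p by omega] at this
      exact (Nat.modEq_zero_iff_dvd).1 (this.trans (by simp [Nat.ModEq]))
    · have := (Nat.modEq_zero_iff_dvd).1 (hi'.symm.trans (Nat.modEq_zero_iff_dvd.2 hd))
      exact absurd (Nat.le_of_dvd (by omega) this) (by omega)
  · rintro ⟨hi, hj, hd, hnd⟩
    have hlt := Nat.mod_lt i hp.pos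
    have hil : i ≡ i % p [MOD p] := (Nat.mod_modEq i p).symm
    have hpos : i % p ≠ 0 := fun h => hnd (Nat.dvd_of_mod_eq_zero h)
    refine ⟨i % p, Finset.mem_Icc.2 (by omega), ⟨hi, hil.trans (hmod _).symm⟩, hj, ?_⟩
    refine Nat.ModEq.trans ?_ (hmod' _).symm
    apply Nat.ModEq.add_left_cancel hil
    rw [show i % p + (p - i % p) = p by omega]
    exact (Nat.modEq_zero_iff_dvd.2 hd).trans (by simp [Nat.ModEq])

theorem exists_modEq_iff {p : ℕ} (hp : Odd p) (i j : ℕ) :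
    (∃ l : ℕ, l ∈ Finset.Icc 1 (p - 1) ∧
        ((i ≡ l * (p + 1) [MOD 2 * p] ∧ j ≡ (p + 1) * (p - l) + p [MOD 2 * p]) ∨
         (i ≡ (p + 1) * (p - l) + p [MOD 2 * p] ∧ j ≡ l * (p + 1) [MOD 2 * p]))) ↔
    ¬ (Even i ↔ Even j) ∧ p ∣ i + j ∧ ¬ p ∣ i := by
  have h1 := exists_modEq_iff_of_even hp i j
  have h2 := exists_modEq_iff_of_even hp j i
  simp only [and_or_left, exists_or]
  rw [h1]
  simp only [and_comm (a := i ≡ _ [MOD _])]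
  rw [h2]
  have h3 : p ∣ i + j → (p ∣ i ↔ p ∣ j) := fun h =>
    ⟨fun h' => (Nat.dvd_add_right h').1 h, fun h' => (Nat.dvd_add_left h').1 h⟩
  rw [add_comm j i]
  simp only [← Nat.not_even_iff_odd]
  tauto

/-! ### Eigenvalues swapped by Frobenius. -/

/-- The middle term is redundant: `(p + 1)(j - i) = (p + 1)(j - ip) + i(p^2 - 1)`. -/
theorem gcd_sub_mul_gcd_eq (p i j : ℤ) :
    gcd (j - i * p) (gcd ((p + 1) * (j - i)) (p ^ 2 - 1)) = gcd (j - i * p) (p ^ 2 - 1) := by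
  apply dvd_antisymm_of_normalize_eq (normalize_gcd _ _) (normalize_gcd _ _)
  · exact dvd_gcd (gcd_dvd_left _ _) ((gcd_dvd_right _ _).trans (gcd_dvd_right _ _))
  · refine dvd_gcd (gcd_dvd_left _ _) (dvd_gcd ?_ (gcd_dvd_right _ _))
    have h1 := (gcd_dvd_left (j - i * p) (p ^ 2 - 1)).mul_left (p + 1)
    have h2 := (gcd_dvd_right (j - i * p) (p ^ 2 - 1)).mul_left i
    convert dvd_add h1 h2 using 1
    ring

theorem isCoprime_two_pow_of_odd {w : ℤ} (hw : Odd w) (n : ℕ) : IsCoprime ((2 : ℤ) ^ n) w := by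
  obtain ⟨k, rfl⟩ := hw
  exact IsCoprime.pow_left ⟨-k, 1, by ring⟩

/-- By Bézout `α ^ gcd u M` is `±1`, and it is `-1` because `α ^ u ≠ 1`. So `u / gcd u M` is odd and
`M / gcd u M` even: `M` contains more factors 2 than `u`. -/
theorem not_dvd_of_zpow_eq_neg_one {K : Type*} [Field K] (h2 : (2 : K) ≠ 0) {α : K} {a : ℕ}
    {u M : ℤ} (hM : ¬ (2 : ℤ) ^ (a + 2) ∣ M) (hα : α ^ M = 1) (hu : α ^ u = -1) :
    ¬ (2 : ℤ) ^ (a + 1) ∣ u ∧ α ^ (gcd u M) = -1 := by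
  have hne : (1 : K) ≠ -1 := fun h => h2 (by linear_combination h)
  have hα0 : α ≠ 0 := by
    rintro rfl
    rcases eq_or_ne u 0 with rfl | h0
    · rw [zpow_zero] at hu; exact hne hu
    · rw [zero_zpow _ h0] at hu
      exact one_ne_zero (by linear_combination hu : (1 : K) = 0)
  obtain ⟨x, y, hxy⟩ := exists_gcd_eq_mul_add_mul u M
  obtain ⟨w, hw⟩ := gcd_dvd_left u M
  obtain ⟨v, hv⟩ := gcd_dvd_right u M
  set D := gcd u M
  have hDx : α ^ D = (-1) ^ x := by
    rw [hxy, zpow_add₀ hα0, zpow_mul, zpow_mul, hu, hα, one_zpow, mul_one]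
  have hD : α ^ D = -1 := by
    rcases Int.even_or_odd x with h | h
    · rw [h.neg_one_zpow] at hDx
      rw [hw, zpow_mul, hDx, one_zpow] at hu
      exact (hne hu).elim
    · rw [hDx, h.neg_one_zpow]
  refine ⟨fun hd => ?_, hD⟩
  have hwodd : Odd w := by
    by_contra h
    rw [Int.not_odd_iff_even] at h
    rw [hw, zpow_mul, hD, h.neg_one_zpow] at hu
    exact hne hu
  have hveven : Even v := by
    by_contra h
    rw [Int.not_even_iff_odd] at h
    rw [hv, zpow_mul, hD, h.neg_one_zpow] at hα
    exact hne hα.symm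
  have hcop : IsCoprime ((2 : ℤ) ^ (a + 1)) w := isCoprime_two_pow_of_odd hwodd _
  rw [hw] at hd
  apply hM
  rw [hv, pow_succ]
  exact mul_dvd_mul (hcop.dvd_of_dvd_mul_right hd) (even_iff_two_dvd.1 hveven)

/-- With `D = gcd u M`, the 2-adic hypotheses make `M / D` even and `u / D` odd. A primitive `2D`-th
root of unity then works: its `t`-th power is `-1` only for odd multiples `t` of `D`. -/
theorem exists_zpow_eq_neg_one {K : Type*} [Field K] {a : ℕ} {u M t : ℤ}
    (hM0 : 0 < M) (hM : (2 : ℤ) ^ (a + 1) ∣ M)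
    (hζ : ∀ d : ℕ, (d : ℤ) ∣ M → ∃ ζ : K, IsPrimitiveRoot ζ d) (hu : ¬ (2 : ℤ) ^ (a + 1) ∣ u)
    (ht : ¬ IsOddMultiple t (gcd u M)) :
    ∃ α : K, α ≠ 0 ∧ α ^ M = 1 ∧ α ^ u = -1 ∧ α ^ t ≠ -1 := by
  have hDpos : 0 < gcd u M := lt_of_le_of_ne (Int.nonneg_iff_normalize_eq_self _ |>.1 (normalize_gcd _ _)) (by
    intro h
    have := (gcd_eq_zero_iff u M).1 h.symm
    omega)
  obtain ⟨w, hw⟩ := gcd_dvd_left u M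
  obtain ⟨v, hv⟩ := gcd_dvd_right u M
  obtain ⟨x, y, hxy⟩ := exists_gcd_eq_mul_add_mul u M
  obtain ⟨D, hD⟩ : ∃ D : ℕ, gcd u M = D := ⟨(gcd u M).toNat, by omega⟩
  rw [hD] at hw hv hxy ht hDpos
  have hcop : IsCoprime w v :=
    ⟨x, y, mul_left_cancel₀ hDpos.ne' (by linear_combination -x * hw - y * hv - hxy)⟩
  have hv2 : Even v := by
    by_contra h
    rw [Int.not_even_iff_odd] at h
    have hc : IsCoprime ((2 : ℤ) ^ (a + 1)) v := isCoprime_two_pow_of_odd h _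
    rw [hv] at hM
    exact hu (hw ▸ (hc.dvd_of_dvd_mul_right hM).mul_right w)
  have hw2 : Odd w := by
    by_contra h
    rw [Int.not_odd_iff_even] at h
    have := hcop.isUnit_of_dvd' h.two_dvd hv2.two_dvd
    exact absurd (Int.isUnit_iff.1 this) (by norm_num)
  obtain ⟨c, hc⟩ := hv2.two_dvd
  have h2D : ((2 * D : ℕ) : ℤ) ∣ M := ⟨c, by rw [hv, hc]; push_cast; ring⟩
  obtain ⟨ζ, hζ⟩ := hζ _ h2D
  have hD0 : 0 < D := by omega
  have hζ0 : ζ ≠ 0 := hζ.ne_zero (by omega)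
  have hζD : ζ ^ (D : ℤ) = -1 := by
    rw [zpow_natCast]
    have h1 : (ζ ^ D) ^ 2 = 1 := by rw [← pow_mul, mul_comm, hζ.pow_eq_one]
    refine (mul_self_eq_one_iff.1 (by rw [← pow_two, h1])).resolve_left fun h => ?_
    exact absurd (Nat.le_of_dvd hD0 ((hζ.pow_eq_one_iff_dvd _).1 h)) (by omega)
  refine ⟨ζ, hζ0, (hζ.zpow_eq_one_iff_dvd _).2 h2D, ?_, fun h => ht ?_⟩
  · rw [hw, zpow_mul, hζD, hw2.neg_one_zpow]
  · have : ζ ^ (t - D) = 1 := by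
      rw [zpow_sub₀ hζ0, h, hζD, div_self (neg_ne_zero.2 one_ne_zero)]
    obtain ⟨k, hk⟩ := (hζ.zpow_eq_one_iff_dvd _).1 this
    refine ⟨2 * k + 1, odd_two_mul_add_one k, ?_⟩
    push_cast at hk
    linear_combination hk

/-- Substituting `β = α ^ p` gives `α ^ (p^2 - 1) = 1`, `α ^ (j - ip) = -1` and `α ^ (j - i) ≠ -1`.
-/
theorem inert_forward {p a : ℕ} {K : Type*} [Field K] (h2 : (2 : K) ≠ 0) (hp : p ≠ 0)
    (hM : ¬ (2 : ℤ) ^ (a + 2) ∣ (p : ℤ) ^ 2 - 1) {α β : K} (hα : α ^ p = β) (hβ : β ^ p = α)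
    {i j : ℕ} (hne : α ≠ β) (h1 : α ^ j = -β ^ i) (h3 : α ^ i ≠ β ^ i) :
    emultiplicity (2 : ℤ) ((j : ℤ) - i * p) ≤ a ∧
      ¬ IsOddMultiple ((j : ℤ) - i) (gcd ((j : ℤ) - i * p) ((p : ℤ) ^ 2 - 1)) := by
  have hα0 : α ≠ 0 := by
    rintro rfl
    rw [zero_pow hp] at hα
    exact hne hα
  have hαM : α ^ ((p : ℤ) ^ 2 - 1) = 1 := by
    rw [zpow_sub₀ hα0, zpow_one, div_eq_one_iff_eq hα0, pow_two, zpow_mul, zpow_natCast,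
      zpow_natCast, hα, hβ]
  have hαu : α ^ ((j : ℤ) - i * p) = -1 := by
    rw [zpow_sub₀ hα0, mul_comm, zpow_mul, zpow_natCast, zpow_natCast, zpow_natCast, hα, h1,
      neg_div, div_self]
    rw [← hα]
    exact pow_ne_zero _ (pow_ne_zero _ hα0)
  obtain ⟨hd, hg⟩ := not_dvd_of_zpow_eq_neg_one h2 hM hαM hαu
  constructor
  · rw [← emultiplicity_lt_iff_not_dvd] at hd
    exact (ENat.lt_add_one_iff (ENat.natCast_ne_top a)).1 (by exact_mod_cast hd)
  · rintro ⟨k, hk, hk'⟩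
    have : α ^ ((j : ℤ) - i) = -1 := by
      rw [hk', mul_comm, zpow_mul, hg, hk.neg_one_zpow]
    rw [zpow_sub₀ hα0, zpow_natCast, zpow_natCast, div_eq_iff (pow_ne_zero _ hα0), h1] at this
    exact h3 (by linear_combination this)

theorem inert_backward {p a : ℕ} (hp : Odd p) (hp1 : 1 < p) {K : Type*} [Field K]
    (hM : (2 : ℤ) ^ (a + 1) ∣ (p : ℤ) ^ 2 - 1)
    (hζ : ∀ d : ℕ, (d : ℤ) ∣ (p : ℤ) ^ 2 - 1 → ∃ ζ : K, IsPrimitiveRoot ζ d) {i j : ℕ}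
    (hu : emultiplicity (2 : ℤ) ((j : ℤ) - i * p) ≤ a)
    (ht : ¬ IsOddMultiple ((j : ℤ) - i) (gcd ((j : ℤ) - i * p) ((p : ℤ) ^ 2 - 1))) :
    ∃ α β : K, α ^ p = β ∧ β ^ p = α ∧ α ^ i = -β ^ j ∧ α ^ j = -β ^ i ∧ α ^ i ≠ β ^ i := by
  have hd : ¬ (2 : ℤ) ^ (a + 1) ∣ (j : ℤ) - i * p := by
    rw [← emultiplicity_lt_iff_not_dvd]
    exact_mod_cast (ENat.lt_add_one_iff (ENat.natCast_ne_top a)).2 hu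
  have hM0 : 0 < (p : ℤ) ^ 2 - 1 := by
    have : (1 : ℤ) < p := by exact_mod_cast hp1
    nlinarith
  obtain ⟨α, hα0, hαM, hαu, hαt⟩ := exists_zpow_eq_neg_one hM0 hM hζ hd ht
  have hβ : (α ^ p) ^ p = α := by
    rwa [zpow_sub₀ hα0, zpow_one, div_eq_one_iff_eq hα0, pow_two, zpow_mul, zpow_natCast,
      zpow_natCast] at hαM
  have h1 : α ^ j = -(α ^ p) ^ i := by
    rw [zpow_sub₀ hα0, mul_comm, zpow_mul, zpow_natCast, zpow_natCast, zpow_natCast,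
      div_eq_iff (pow_ne_zero _ (pow_ne_zero _ hα0))] at hαu
    linear_combination hαu
  refine ⟨α, α ^ p, rfl, hβ, ?_, h1, fun h => hαt ?_⟩
  · rw [← pow_mul α, mul_comm, pow_mul, h1, hp.neg_pow, pow_right_comm, hβ, neg_neg]
  · rw [zpow_sub₀ hα0, zpow_natCast, zpow_natCast, h1, ← h, neg_div, div_self (pow_ne_zero _ hα0)]

/-! ### Assembling the cases. -/

theorem corollary3p11 (p a : ℕ) (hp : p.Prime)
    (hpa : (2 ≤ a ∧ ∃ b : ℕ, p = 2 ^ a * (2 * b + 1) - 1) ∨ (a.Prime ∧ p = 2 ^ a - 1))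
    (i j : ℕ) (hi : 0 < i) (hj : 0 < j) :
    (i, j, 1, 1) ∈ matrixHomSet (ZMod p) ↔
      (Odd i ∧ Odd j) ∨
      (¬ (Even i ↔ Even j) ∧
        ¬ IsOddMultiple (gcd ((j : ℤ) - i) ((p : ℤ) - 1))
          (gcd ((j : ℤ) + i) ((p : ℤ) - 1))) ∨
      (∃ l : ℕ, l ∈ Finset.Icc 1 (p - 1) ∧
        ((i ≡ l * (p + 1) [MOD 2 * p] ∧ j ≡ (p + 1) * (p - l) + p [MOD 2 * p]) ∨
         (i ≡ (p + 1) * (p - l) + p [MOD 2 * p] ∧ j ≡ l * (p + 1) [MOD 2 * p]))) ∨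
      (emultiplicity (2 : ℤ) ((j : ℤ) - i * p) ≤ a ∧
        ¬ IsOddMultiple ((j : ℤ) - i)
          (gcd ((j : ℤ) - i * p) (gcd (((p : ℤ) + 1) * ((j : ℤ) - i)) ((p : ℤ) ^ 2 - 1)))) := by
  have : Fact p.Prime := ⟨hp⟩
  obtain ⟨ha, b, hb⟩ : 2 ≤ a ∧ ∃ b : ℕ, p + 1 = 2 ^ a * (2 * b + 1) := by
    rcases hpa with ⟨ha, b, hb⟩ | ⟨ha, hb⟩
    · have : 0 < 2 ^ a * (2 * b + 1) := by positivity
      exact ⟨ha, b, by omega⟩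
    · have : 0 < 2 ^ a := by positivity
      exact ⟨ha.two_le, 0, by omega⟩
  -- Here `2 ≤ a` is used: it makes `p` congruent to 3 modulo 4.
  obtain ⟨h, hph, hh⟩ : ∃ h, p = 2 * h + 1 ∧ Odd h := by
    obtain ⟨c, rfl⟩ := Nat.exists_eq_add_of_le ha
    have h4 : 4 ∣ p + 1 := by
      rw [hb, pow_add, mul_assoc]
      exact Dvd.intro _ rfl
    exact ⟨(p - 1) / 2, by omega, by rw [Nat.odd_iff]; omega⟩
  have hpodd : Odd p := ⟨h, hph⟩
  let K := AlgebraicClosure (ZMod p)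
  have hchar : CharP K p := charP_of_injective_algebraMap (algebraMap (ZMod p) K).injective p
  have hp2 : p ≠ 2 := by omega
  have h2 : (2 : K) ≠ 0 := by
    intro h0
    have : ((2 : ℕ) : K) = 0 := by exact_mod_cast h0
    rw [CharP.cast_eq_zero_iff K p] at this
    exact hp2 ((Nat.prime_dvd_prime_iff_eq hp Nat.prime_two).1 this)
  have hfac : (p : ℤ) ^ 2 - 1 = 2 ^ (a + 1) * ((2 * b + 1) * h) := by
    have hb' : (p : ℤ) + 1 = 2 ^ a * (2 * b + 1) := by exact_mod_cast hb
    have hph' : (p : ℤ) = 2 * h + 1 := by exact_mod_cast hph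
    rw [pow_succ]
    linear_combination (p - 1 : ℤ) * hb' + 2 ^ a * (2 * b + 1 : ℤ) * hph'
  have hM1 : (2 : ℤ) ^ (a + 1) ∣ (p : ℤ) ^ 2 - 1 := ⟨_, hfac⟩
  have hM2 : ¬ (2 : ℤ) ^ (a + 2) ∣ (p : ℤ) ^ 2 - 1 := by
    rw [hfac, show a + 2 = a + 1 + 1 from rfl, pow_succ _ (a + 1),
      mul_dvd_mul_iff_left (by positivity), ← even_iff_two_dvd, Int.not_even_iff_odd]
    exact (odd_two_mul_add_one _).mul (by exact_mod_cast hh)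
  have hζ : ∀ d : ℕ, (d : ℤ) ∣ (p : ℤ) ^ 2 - 1 → ∃ ζ : K, IsPrimitiveRoot ζ d := by
    intro d hd
    -- A divisor of `p^2 - 1` is prime to the characteristic, so primitive roots of that order exist
    -- in `K`.
    have : NeZero (d : K) := ⟨fun h0 => by
      rw [CharP.cast_eq_zero_iff K p] at h0
      have h1 : (p : ℤ) ∣ (p : ℤ) ^ 2 - 1 := (Int.natCast_dvd_natCast.2 h0).trans hd
      have h3 : (p : ℤ) ∣ 1 := by
        have := dvd_sub (dvd_pow_self (p : ℤ) two_ne_zero) h1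
        rwa [sub_sub_cancel] at this
      exact hp.one_lt.ne' (Nat.dvd_one.1 (by exact_mod_cast h3))⟩
    exact HasEnoughRootsOfUnity.exists_primitiveRoot K d
  have hζ' : ∀ d : ℕ, d ∣ p - 1 → ∃ ζ : K, IsPrimitiveRoot ζ d := by
    intro d hd
    apply hζ
    have : (d : ℤ) ∣ (p : ℤ) - 1 := by
      have := Int.natCast_dvd_natCast.2 hd
      rwa [Nat.cast_sub hp.one_lt.le, Nat.cast_one] at this
    rw [show (p : ℤ) ^ 2 - 1 = (p - 1) * (p + 1) by ring]
    exact this.mul_right _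
  obtain ⟨m, rfl⟩ := Nat.exists_eq_add_of_le' hi
  obtain ⟨n, rfl⟩ := Nat.exists_eq_add_of_le' hj
  rw [gcd_sub_mul_gcd_eq, exists_modEq_iff hpodd, mem_matrixHomSet_iff_exists_matrix hi hj,
    exists_matrix_iff_exists_lucasU, exists_lucasU_iff_exists_roots hp2 K]
  constructor
  · rintro ⟨α, β, hF, h1, h3, ⟨hne, h4⟩ | ⟨rfl, h4, h5⟩⟩
    · rcases hF with ⟨hα, hβ⟩ | ⟨hα, hβ⟩
      · have hα0 : α ≠ 0 := by
          rintro rfl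
          rw [zero_pow n.succ_ne_zero, eq_comm, neg_eq_zero] at h3
          exact hne (pow_eq_zero_iff m.succ_ne_zero |>.1 h3).symm
        have hβ0 : β ≠ 0 := by
          rintro rfl
          rw [zero_pow m.succ_ne_zero, neg_zero] at h3
          exact hne (pow_eq_zero_iff n.succ_ne_zero |>.1 h3)
        exact (parity_condition_of_split hph hh h2 hα0 hβ0 hα hβ h1 h3 h4).imp_right .inl
      · exact .inr (.inr (.inr (inert_forward h2 hp.ne_zero hM2 hα hβ hne h3 h4)))
    · have hα : α ^ p = α := by rcases hF with ⟨hα, -⟩ | ⟨hα, -⟩ <;> exact hα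
      exact (double_root_forward hph hh h2 hα h1 h4 h5).imp_right fun h => .inr (.inl h)
  · rintro (⟨hi, hj⟩ | ⟨hpar, hodd⟩ | ⟨hpar, hd, hnd⟩ | ⟨hu, ht⟩)
    · have hne : (1 : K) ≠ -1 := fun he => h2 (by linear_combination he)
      refine ⟨1, -1, .inl ⟨one_pow _, hpodd.neg_one_pow⟩, ?_, ?_, .inl ⟨hne, ?_⟩⟩
      · rw [hj.neg_one_pow, one_pow, neg_neg]
      · rw [hi.neg_one_pow, one_pow, neg_neg]
      · rw [hi.neg_one_pow, one_pow]
        exact hne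
    · obtain ⟨α, β, hα, hβ, h1, h3, h4⟩ := exists_split_of_not_isOddMultiple hpodd hζ' hpar hodd
      exact ⟨α, β, .inl ⟨hα, hβ⟩, h1, h3, .inl ⟨fun he => h4 (by rw [he]), h4⟩⟩
    · obtain ⟨h1, h3, h4⟩ := double_root_backward (K := K) hpar hd hnd
      exact ⟨-1, -1, .inl ⟨hpodd.neg_one_pow, hpodd.neg_one_pow⟩, h1, by rw [h1, neg_neg],
        .inr ⟨rfl, h3, h4⟩⟩
    · obtain ⟨α, β, hα, hβ, h1, h3, h4⟩ := inert_backward hpodd hp.one_lt hM1 hζ hu ht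
      exact ⟨α, β, .inr ⟨hα, hβ⟩, h1, h3, .inl ⟨fun he => h4 (by rw [he]), h4⟩⟩
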